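/- Let $r \ge 1$ be an integer, let $a, w_1, \dots, w_r > 0$ be real, and put $\boldsymbol{w} = (w_1, \dots, w_r)$. Let $\zeta_r(s, \boldsymbol{w}, a)$ be the Barnes $r$-ple zeta function, that is, the meromorphic continuation to $\mathbb{C}$, holomorphic outside $s = 1, 2, \dots, r$, of $$\zeta_r(s, \boldsymbol{w}, a) = \sum_{m_1=0}^{\infty} \cdots \sum_{m_r=0}^{\infty} \frac{1}{(a + m_1 w_1 + \cdots + m_r w_r)^s}, \qquad \operatorname{Re}(s) > r.$$ Let the generalized $r$-ple Bernoulli polynomials $B_k^{(r)}(x, \boldsymbol{w})$, $k \ge 0$, be defined by $$\frac{t^r e^{(w_1 + \cdots + w_r - x)t}}{(e^{w_1 t} - 1) \cdots (e^{w_r t} - 1)} = \sum_{k=0}^{\infty} B_k^{(r)}(x, \boldsymbol{w}) \frac{t^k}{k!}, \qquad |t| < \min\{2\pi/w_1, \dots, 2\pi/w_r\}.$$ Let $N \ge -r$ be an integer. If $B_{r+N+1}^{(r)}(a, \boldsymbol{w})\, B_{r+N}^{(r)}(a, \boldsymbol{w}) > 0$, then there is a real number $\sigma \in (-N-1, -N)$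 such that $\zeta_r(\sigma, \boldsymbol{w}, a) = 0$. -/

import Mathlib

/-- The formal power series `(e^{w t} - 1) / t = ∑ w ^ (n + 1) / (n + 1)! * t ^ n` in `t`. -/
noncomputable def expSubOneDiv (w : ℝ) : PowerSeries ℝ :=
  PowerSeries.mk fun n => w ^ (n + 1) / ((n + 1).factorial : ℝ)

/-- The Taylor series at `t = 0` of
`t ^ r * e^{(w_1 + ... + w_r - x) t} / ((e^{w_1 t} - 1) ... (e^{w_r t} - 1))`. -/
noncomputable def barnesBernoulliSeries {r : ℕ} (w : Fin r → ℝ) (x : ℝ) : PowerSeries ℝ :=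
  PowerSeries.rescale ((∑ i, w i) - x) (PowerSeries.exp ℝ) * (∏ i, expSubOneDiv (w i))⁻¹

/-- The generalized `r`-ple Bernoulli polynomial `B_k^{(r)}(x, w)`: `k!` times the coefficient
of `t ^ k` in the generating function. -/
noncomputable def barnesBernoulli {r : ℕ} (k : ℕ) (x : ℝ) (w : Fin r → ℝ) : ℝ :=
  (k.factorial : ℝ) * PowerSeries.coeff k (barnesBernoulliSeries w x)

theorem X_mul_expSubOneDiv (w : ℝ) :
    PowerSeries.X * expSubOneDiv w = PowerSeries.rescale w (PowerSeries.exp ℝ) - 1 := by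
  ext n
  cases n with
  | zero =>
    rw [map_sub, PowerSeries.coeff_rescale, PowerSeries.coeff_exp]
    simp
  | succ n =>
    rw [PowerSeries.coeff_succ_X_mul]
    simp [expSubOneDiv, PowerSeries.coeff_rescale, PowerSeries.coeff_exp, PowerSeries.coeff_one,
      div_eq_mul_inv]

/-- The generating function identity with its denominators cleared. -/
theorem barnesBernoulliSeries_mul {r : ℕ} (w : Fin r → ℝ) (hw : ∀ i, 0 < w i) (x : ℝ) :
    barnesBernoulliSeries w x * ∏ i, (PowerSeries.rescale (w i) (PowerSeries.exp ℝ) - 1) =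
      PowerSeries.X ^ r * PowerSeries.rescale ((∑ i, w i) - x) (PowerSeries.exp ℝ) := by
  have h : PowerSeries.constantCoeff (∏ i, expSubOneDiv (w i)) ≠ 0 := by
    rw [map_prod, Finset.prod_ne_zero_iff]
    intro i _
    simpa [expSubOneDiv, ← PowerSeries.coeff_zero_eq_constantCoeff_apply] using (hw i).ne'
  simp only [← X_mul_expSubOneDiv, Finset.prod_mul_distrib, Finset.prod_const, Finset.card_univ,
    Fintype.card_fin, barnesBernoulliSeries]
  calc _ = PowerSeries.X ^ r * PowerSeries.rescale ((∑ i, w i) - x) (PowerSeries.exp ℝ) *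
        ((∏ i, expSubOneDiv (w i))⁻¹ * ∏ i, expSubOneDiv (w i)) := by ring
    _ = _ := by rw [PowerSeries.inv_mul_cancel _ h, mul_one]

/-- `Z` is a meromorphic continuation to `ℂ` of the Barnes `r`-ple zeta series
`∑ 1 / (a + m_1 w_1 + ... + m_r w_r) ^ s` (over all `m ∈ ℕ ^ r`, absolutely convergent for
`Re s > r`), with no singularities other than poles at `s = 1, ..., r`.  Its values at
`s ≠ 1, ..., r` are unique by the identity theorem. -/
structure IsBarnesZeta {r : ℕ} (w : Fin r → ℝ) (a : ℝ) (Z : ℂ → ℂ) : Prop where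
  hasSum : ∀ s : ℂ, (r : ℝ) < s.re →
    HasSum (fun m : Fin r → ℕ => 1 / ((a + ∑ i, (m i : ℝ) * w i : ℝ) : ℂ) ^ s) (Z s)
  differentiableOn : DifferentiableOn ℂ Z {s : ℂ | ∀ j : ℕ, 1 ≤ j → j ≤ r → s ≠ (j : ℂ)}
  meromorphicOn : MeromorphicOn Z Set.univ

open Classical in
/-- The Barnes `r`-ple zeta function `ζ_r(s, w, a)` on `ℂ`: the meromorphic continuation of its
defining series.  (The default value `1` would only be taken if there were no continuation.) -/
noncomputable def barnesZeta {r : ℕ} (s : ℂ) (w : Fin r → ℝ) (a : ℝ) : ℂ :=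
  if h : ∃ Z : ℂ → ℂ, IsBarnesZeta w a Z then h.choose s else 1

/-! For `Re s > r`, `Γ(s) ζ_r(s)` is the Mellin transform of `e^{-at} ∏ (1 - e^{-w_i t})⁻¹`.
Multiplied by `t ^ r`, this kernel is the Bernoulli generating function, so at `0+` it expands as `∑
c_k t ^ (k - r)` with `c_k = B_k / k!`. Subtracting the first `K` terms on `(0, 1]` continues the
transform to `Re s > r - K` as a holomorphic function plus `∑_{k < K} c_k / (s - (r - k))`.

Put `n = r + N`. The endpoints `-N = r - n` and `-N - 1 = r - n - 1` then carry the residues `c_n`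
and `c_{n+1}`, which have the same sign by hypothesis. On the open interval between them `Γ ζ_r` is
real and continuous, and it tends to infinities of opposite sign at the two ends. Hence it vanishes
inside, and multiplying by the entire function `1 / Γ` gives a zero of `ζ_r`. The pole argument is
`exists_add_div_add_div_eq_zero`; the continuation is `isBarnesZeta_barnesZetaCont`, and
`IsBarnesZeta.eq` identifies it with `barnesZeta`. -/

open Filter Topology Asymptotics Set

/-! ### Calculus of one-sided asymptotic expansions -/

/-- `g` has the formal power series `P` as its asymptotic expansion as `t → 0+`. -/
def HasRightExpansion (g : ℝ → ℝ) (P : PowerSeries ℝ) : Prop :=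
  ∀ K : ℕ, ∃ p : Polynomial ℝ, PowerSeries.X ^ K ∣ P - (p : PowerSeries ℝ) ∧
    (fun t => g t - p.eval t) =O[𝓝[>] 0] fun t => t ^ K

theorem Polynomial.eval_isBigO_pow_of_X_pow_dvd {p : Polynomial ℝ} {K : ℕ}
    (h : (PowerSeries.X : PowerSeries ℝ) ^ K ∣ (p : PowerSeries ℝ)) :
    (fun t => p.eval t) =O[𝓝[>] 0] fun t => t ^ K := by
  have h' : Polynomial.X ^ K ∣ p := by
    rw [Polynomial.X_pow_dvd_iff]
    rw [PowerSeries.X_pow_dvd_iff] at h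
    simpa using h
  obtain ⟨q, rfl⟩ := h'
  have hq : (fun t => q.eval t) =O[𝓝[>] 0] fun _ => (1 : ℝ) :=
    (q.continuous.continuousAt.tendsto.mono_left nhdsWithin_le_nhds).isBigO_one ℝ
  simpa using (isBigO_refl (fun t : ℝ => t ^ K) (𝓝[>] 0)).mul hq

namespace PowerSeries

theorem X_pow_dvd_sub_trunc (P : PowerSeries ℝ) (K : ℕ) :
    X ^ K ∣ P - (P.trunc K : PowerSeries ℝ) := by
  rw [X_pow_dvd_iff]
  intro m hm
  simp [coeff_trunc, hm]

theorem eval_trunc_eq_sum (P : PowerSeries ℝ) (K : ℕ) (t : ℝ) :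
    (P.trunc K).eval t = ∑ k ∈ Finset.range K, coeff k P * t ^ k := by
  rw [Polynomial.eval, eval₂_trunc_eq_sum_range]
  simp

end PowerSeries

namespace HasRightExpansion

variable {g h : ℝ → ℝ} {P Q : PowerSeries ℝ}

theorem of_isBigO (H : ∀ K : ℕ, (fun t => g t - ∑ k ∈ Finset.range K, PowerSeries.coeff k P * t ^ k)
    =O[𝓝[>] 0] fun t => t ^ K) : HasRightExpansion g P := fun K =>
  ⟨P.trunc K, P.X_pow_dvd_sub_trunc K, by simpa only [PowerSeries.eval_trunc_eq_sum] using H K⟩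

/-- Two polynomials congruent modulo `X ^ K` differ by `O(t ^ K)`, so any witness can be exchanged
for the truncation. Leaving the witness free lets `mul` use `p * q` without truncating again. -/
theorem isBigO (H : HasRightExpansion g P) (K : ℕ) :
    (fun t => g t - ∑ k ∈ Finset.range K, PowerSeries.coeff k P * t ^ k)
      =O[𝓝[>] 0] fun t => t ^ K := by
  obtain ⟨p, hp, hg⟩ := H K
  have hd : (PowerSeries.X : PowerSeries ℝ) ^ K ∣ ((p - P.trunc K : Polynomial ℝ) : PowerSeries ℝ) := by
    have := dvd_sub (P.X_pow_dvd_sub_trunc K) hp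
    simpa using this
  refine (hg.add (Polynomial.eval_isBigO_pow_of_X_pow_dvd hd)).congr_left fun t => ?_
  rw [Polynomial.eval_sub, PowerSeries.eval_trunc_eq_sum]
  ring

theorem tendsto (H : HasRightExpansion g P) :
    Tendsto g (𝓝[>] 0) (𝓝 (PowerSeries.constantCoeff P)) := by
  have h1 := H.isBigO 1
  have h2 : Tendsto (fun t : ℝ => t ^ 1) (𝓝[>] 0) (𝓝 0) := by
    simpa using ((continuous_pow 1).tendsto (0 : ℝ)).mono_left nhdsWithin_le_nhds
  have h3 := (h1.trans_tendsto h2).add_const (PowerSeries.constantCoeff P)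
  simpa using h3

theorem isBigO_one (H : HasRightExpansion g P) : g =O[𝓝[>] 0] fun _ => (1 : ℝ) :=
  H.tendsto.isBigO_one ℝ

theorem mul (hg : HasRightExpansion g P) (hh : HasRightExpansion h Q) :
    HasRightExpansion (fun t => g t * h t) (P * Q) := by
  intro K
  obtain ⟨p, hp, hgp⟩ := hg K
  obtain ⟨q, hq, hhq⟩ := hh K
  refine ⟨p * q, ?_, ?_⟩
  · have := dvd_add (hp.mul_right Q) (hq.mul_left (p : PowerSeries ℝ))
    convert this using 1
    push_cast
    ring
  · have hp1 : (fun t => p.eval t) =O[𝓝[>] 0] fun _ => (1 : ℝ) :=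
      (p.continuous.continuousAt.tendsto.mono_left nhdsWithin_le_nhds).isBigO_one ℝ
    have := (hgp.mul hh.isBigO_one).add ((hp1.mul hhq).congr_right (g₂ := fun t => t ^ K * 1)
      fun t => by ring)
    refine (this.congr_left fun t => ?_).congr_right fun t => mul_one _
    rw [Polynomial.eval_mul]
    ring

theorem one : HasRightExpansion (fun _ => 1) 1 := fun K =>
  ⟨1, by simp, by simpa using isBigO_zero _ _⟩

theorem prod {ι : Type*} (s : Finset ι) {g : ι → ℝ → ℝ} {P : ι → PowerSeries ℝ}
    (H : ∀ i ∈ s, HasRightExpansion (g i) (P i)) :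
    HasRightExpansion (fun t => ∏ i ∈ s, g i t) (∏ i ∈ s, P i) := by
  classical
  induction s using Finset.induction_on with
  | empty => simpa using one
  | insert i s hi ih =>
    simp only [Finset.prod_insert hi]
    exact (H i (Finset.mem_insert_self i s)).mul
      (ih fun j hj => H j (Finset.mem_insert_of_mem hj))

/-- Division of expansions: with `q` a truncation of the formal quotient, `g - q = u⁻¹ (v - u q)`.
The bracket is `O(t ^ K)` and `u⁻¹` is bounded because `u` has a nonzero limit. -/
theorem mul_inv_of_mul_eq {u v : ℝ → ℝ} (hu : HasRightExpansion u P) (hv : HasRightExpansion v Q)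
    (hP : PowerSeries.constantCoeff P ≠ 0) (hg : ∀ᶠ t in 𝓝[>] 0, u t * g t = v t) :
    HasRightExpansion g (Q * P⁻¹) := by
  intro K
  have hdvd := (Q * P⁻¹).X_pow_dvd_sub_trunc K
  set q := (Q * P⁻¹).trunc K
  refine ⟨q, hdvd, ?_⟩
  obtain ⟨pu, hpu, hu'⟩ := hu K
  obtain ⟨pv, hpv, hv'⟩ := hv K
  have hq1 : (fun t => q.eval t) =O[𝓝[>] 0] fun _ => (1 : ℝ) :=
    (q.continuous.continuousAt.tendsto.mono_left nhdsWithin_le_nhds).isBigO_one ℝ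
  have hd : (PowerSeries.X : PowerSeries ℝ) ^ K ∣ ((pv - pu * q : Polynomial ℝ) : PowerSeries ℝ) := by
    have h1 := dvd_sub (dvd_add (hdvd.mul_left P) (hpu.mul_right (q : PowerSeries ℝ))) hpv
    convert h1 using 1
    have : P * (Q * P⁻¹) = Q := by
      rw [mul_left_comm, PowerSeries.mul_inv_cancel _ hP, mul_one]
    push_cast
    linear_combination -this
  have hmain : (fun t => v t - u t * q.eval t) =O[𝓝[>] 0] fun t => t ^ K := by
    have h2 : (fun t => (u t - pu.eval t) * q.eval t) =O[𝓝[>] 0] fun t => t ^ K := by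
      simpa using hu'.mul hq1
    refine ((hv'.add (Polynomial.eval_isBigO_pow_of_X_pow_dvd hd)).sub h2).congr_left fun t => ?_
    simp only [Polynomial.eval_sub, Polynomial.eval_mul]
    ring
  have hinv : (fun t => (u t)⁻¹) =O[𝓝[>] 0] fun _ => (1 : ℝ) := (hu.tendsto.inv₀ hP).isBigO_one ℝ
  refine (hinv.mul hmain).congr' ?_ (Eventually.of_forall fun t => one_mul _)
  filter_upwards [hg, hu.tendsto.eventually_ne hP] with t ht hne
  rw [← ht]
  field_simp

theorem exp_mul (b : ℝ) : HasRightExpansion (fun t => Real.exp (b * t))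
    (PowerSeries.rescale b (PowerSeries.exp ℝ)) := by
  refine of_isBigO fun K => ?_
  have ht : Tendsto (fun t : ℝ => b * t) (𝓝[>] 0) (𝓝 0) := by
    have : Continuous fun t : ℝ => b * t := by fun_prop
    simpa using (this.tendsto 0).mono_left nhdsWithin_le_nhds
  have h := (Real.exp_sub_sum_range_isBigO_pow K).comp_tendsto ht
  have h2 : (fun t : ℝ => (b * t) ^ K) =O[𝓝[>] 0] fun t => t ^ K := by
    simp only [mul_pow]
    exact isBigO_const_mul_self _ _ _
  refine (h.trans h2).congr_left fun t => ?_
  simp only [Function.comp_apply]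
  congr 1
  refine Finset.sum_congr rfl fun k _ => ?_
  simp [PowerSeries.coeff_rescale, PowerSeries.coeff_exp, mul_pow]
  ring

theorem exp_sub_one_div (w : ℝ) :
    HasRightExpansion (fun t => (Real.exp (w * t) - 1) / t) (expSubOneDiv w) := by
  refine of_isBigO fun K => ?_
  -- One extra order is needed, since division by `t` loses one.
  have h := ((exp_mul w).isBigO (K + 1)).mul (isBigO_refl (fun t : ℝ => t⁻¹) (𝓝[>] 0))
  refine h.congr' ?_ ?_
  · filter_upwards [self_mem_nhdsWithin] with t ht
    have ht' : t ≠ 0 := (mem_Ioi.1 ht).ne'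
    rw [Finset.sum_range_succ', ← sub_sub, sub_mul, sub_mul, Finset.sum_mul, sub_right_comm,
      div_eq_mul_inv, sub_mul]
    congr 1
    · simp
    · refine Finset.sum_congr rfl fun k _ => ?_
      simp [expSubOneDiv, PowerSeries.coeff_rescale, PowerSeries.coeff_exp]
      field_simp
      ring
  · filter_upwards [self_mem_nhdsWithin] with t ht
    have ht' : t ≠ 0 := (mem_Ioi.1 ht).ne'
    rw [pow_succ, mul_inv_cancel_right₀ ht']

end HasRightExpansion

/-! ### The lattice series, its kernel and the Mellin transform -/

theorem hasSum_prod_fin_of_nonneg {r : ℕ} {g : Fin r → ℕ → ℝ} {S : Fin r → ℝ}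
    (h0 : ∀ i n, 0 ≤ g i n) (hg : ∀ i, HasSum (g i) (S i)) :
    HasSum (fun m : Fin r → ℕ => ∏ i, g i (m i)) (∏ i, S i) := by
  induction r with
  | zero => simp
  | succ r ih =>
    have ih' := ih (g := fun i => g i.succ) (fun i => h0 i.succ) fun i => hg i.succ
    have hnn : 0 ≤ fun m : Fin r → ℕ => ∏ i : Fin r, g i.succ (m i) :=
      fun m => Finset.prod_nonneg fun i _ => h0 i.succ (m i)
    have hs := Summable.mul_of_nonneg (hg 0).summable ih'.summable (h0 0) hnn
    have h := HasSum.mul (hg 0) ih' hs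
    rw [← (Fin.consEquiv fun _ => ℕ).hasSum_iff]
    simpa [Function.comp_def, Fin.prod_univ_succ, Fin.consEquiv] using h

section Barnes

variable {r : ℕ} {w : Fin r → ℝ} {a : ℝ}

theorem barnesLattice_pos (hw : ∀ i, 0 < w i) (ha : 0 < a) (m : Fin r → ℕ) :
    0 < a + ∑ i, (m i : ℝ) * w i :=
  add_pos_of_pos_of_nonneg ha
    (Finset.sum_nonneg fun i _ => mul_nonneg (Nat.cast_nonneg _) (hw i).le)

/-- Each of the `r` factors `min a (w i) * (m i + 1)` is at most the lattice value. This dominates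
the multiple series by a product of one-dimensional series with exponent `σ / r > 1`. -/
theorem exists_mul_prod_le_barnesLattice_pow (hw : ∀ i, 0 < w i) (ha : 0 < a) :
    ∃ δ : ℝ, 0 < δ ∧ ∀ m : Fin r → ℕ,
      δ * ∏ i, ((m i : ℝ) + 1) ≤ (a + ∑ i, (m i : ℝ) * w i) ^ r := by
  refine ⟨∏ i, min a (w i), Finset.prod_pos fun i _ => lt_min ha (hw i), fun m => ?_⟩
  rw [← Finset.prod_mul_distrib]
  calc ∏ i, min a (w i) * ((m i : ℝ) + 1)
      ≤ ∏ _i : Fin r, (a + ∑ i, (m i : ℝ) * w i) := by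
        refine Finset.prod_le_prod
          (fun i _ => mul_nonneg (lt_min ha (hw i)).le (by positivity)) fun i _ => ?_
        have h1 : (m i : ℝ) * w i ≤ ∑ j, (m j : ℝ) * w j :=
          Finset.single_le_sum (f := fun j => (m j : ℝ) * w j)
            (fun j _ => mul_nonneg (Nat.cast_nonneg _) (hw j).le) (Finset.mem_univ i)
        have h2 : min a (w i) * m i ≤ w i * m i :=
          mul_le_mul_of_nonneg_right (min_le_right _ _) (Nat.cast_nonneg _)
        have h3 := min_le_left a (w i)
        nlinarith
    _ = _ := by simp

theorem summable_barnesLattice_rpow (hw : ∀ i, 0 < w i) (ha : 0 < a) {σ : ℝ} (hσ : (r : ℝ) < σ) :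
    Summable fun m : Fin r → ℕ => 1 / (a + ∑ i, (m i : ℝ) * w i) ^ σ := by
  rcases Nat.eq_zero_or_pos r with rfl | hr
  · exact Summable.of_finite
  have hr' : (0 : ℝ) < r := Nat.cast_pos.2 hr
  obtain ⟨δ, hδ, H⟩ := exists_mul_prod_le_barnesLattice_pow hw ha
  have hq : 1 < σ / r := by rwa [one_lt_div hr']
  have h1 : Summable fun n : ℕ => 1 / ((n : ℝ) + 1) ^ (σ / r) := by
    simpa using (summable_nat_add_iff 1).2 (Real.summable_one_div_nat_rpow.2 hq)
  have h2 := (hasSum_prod_fin_of_nonneg (r := r) (g := fun _ n => 1 / ((n : ℝ) + 1) ^ (σ / r))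
    (fun _ n => by positivity) fun _ => h1.hasSum).summable.mul_left (1 / δ ^ (σ / r))
  refine Summable.of_nonneg_of_le (fun m => ?_) (fun m => ?_) h2
  · have := barnesLattice_pos hw ha m
    positivity
  · have hp := barnesLattice_pos hw ha m
    have hP : 0 < ∏ i, ((m i : ℝ) + 1) := Finset.prod_pos fun i _ => by positivity
    have h3 := Real.rpow_le_rpow (by positivity) (H m) (by positivity : 0 ≤ σ / r)
    rw [← Real.rpow_natCast, ← Real.rpow_mul hp.le, mul_div_cancel₀ _ hr'.ne',
      Real.mul_rpow hδ.le hP.le] at h3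
    rw [Finset.prod_div_distrib, Finset.prod_const_one, one_div_mul_one_div,
      Real.finsetProd_rpow _ _ fun i _ => by positivity]
    exact one_div_le_one_div_of_le (by positivity) h3

/-- The Laplace-type kernel whose Mellin transform is `Γ(s) ζ_r(s, w, a)`. -/
noncomputable def barnesKernel (w : Fin r → ℝ) (a t : ℝ) : ℝ :=
  Real.exp (-a * t) * ∏ i, (1 - Real.exp (-w i * t))⁻¹

theorem one_sub_exp_neg_mul_pos {v t : ℝ} (hv : 0 < v) (ht : 0 < t) :
    0 < 1 - Real.exp (-v * t) := by
  have : Real.exp (-v * t) < 1 := Real.exp_lt_one_iff.2 (by nlinarith)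
  linarith

theorem hasSum_barnesKernel (hw : ∀ i, 0 < w i) {t : ℝ} (ht : 0 < t) :
    HasSum (fun m : Fin r → ℕ => Real.exp (-(a + ∑ i, (m i : ℝ) * w i) * t))
      (barnesKernel w a t) := by
  have h := hasSum_prod_fin_of_nonneg (r := r) (g := fun i n => Real.exp (-w i * t) ^ n)
    (fun _ _ => by positivity) fun i => hasSum_geometric_of_lt_one (Real.exp_pos _).le
      (by linarith [one_sub_exp_neg_mul_pos (hw i) ht])
  refine Eq.subst (motive := fun F => HasSum F (barnesKernel w a t)) (funext fun m => Eq.symm ?_)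
    (h.mul_left (Real.exp (-a * t)))
  rw [Finset.prod_congr rfl fun i _ => (Real.exp_nat_mul (-w i * t) (m i)).symm, ← Real.exp_sum,
    ← Real.exp_add, neg_mul, add_mul, Finset.sum_mul, neg_add, ← Finset.sum_neg_distrib, neg_mul]
  congr 2
  exact Finset.sum_congr rfl fun i _ => by ring

theorem hasSum_mellin_barnesKernel (hw : ∀ i, 0 < w i) (ha : 0 < a) {s : ℂ} (hs : (r : ℝ) < s.re) :
    HasSum (fun m : Fin r → ℕ => 1 / ((a + ∑ i, (m i : ℝ) * w i : ℝ) : ℂ) ^ s)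
      (mellin (fun t => (barnesKernel w a t : ℂ)) s * (Complex.Gamma s)⁻¹) := by
  have hs0 : 0 < s.re := (Nat.cast_nonneg r).trans_lt hs
  have h := hasSum_mellin (ι := Fin r → ℕ) (a := fun _ => 1)
    (p := fun m => a + ∑ i, (m i : ℝ) * w i) (F := fun t => (barnesKernel w a t : ℂ)) (s := s)
    (fun m => Or.inr (barnesLattice_pos hw ha m)) hs0
    (fun t ht => by
      simpa only [one_mul] using Complex.hasSum_ofReal.2 (hasSum_barnesKernel (a := a) hw ht))
    (by simpa using summable_barnesLattice_rpow hw ha hs)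
  refine Eq.subst (motive := fun F => HasSum F
    (mellin (fun t => (barnesKernel w a t : ℂ)) s * (Complex.Gamma s)⁻¹))
    (funext fun m => Eq.symm ?_) (h.mul_right (Complex.Gamma s)⁻¹)
  rw [mul_one, div_mul_eq_mul_div, mul_inv_cancel₀ (Complex.Gamma_ne_zero_of_re_pos hs0)]

theorem continuousOn_barnesKernel (hw : ∀ i, 0 < w i) :
    ContinuousOn (barnesKernel w a) (Ioi 0) := by
  unfold barnesKernel
  refine ContinuousOn.mul (by fun_prop) (continuousOn_finsetProd _ fun i _ => ?_)
  exact ContinuousOn.inv₀ (by fun_prop) fun t ht => (one_sub_exp_neg_mul_pos (hw i) ht).ne'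

theorem barnesKernel_isBigO_atTop (hw : ∀ i, 0 < w i) :
    barnesKernel w a =O[atTop] fun t => Real.exp (-a * t) := by
  have h : Tendsto (fun t => ∏ i, (1 - Real.exp (-w i * t))⁻¹) atTop
      (𝓝 (∏ _i : Fin r, (1 - 0 : ℝ)⁻¹)) := by
    refine tendsto_finsetProd _ fun i _ => Tendsto.inv₀ (tendsto_const_nhds.sub ?_) (by simp)
    exact Real.tendsto_exp_atBot.comp
      (tendsto_id.const_mul_atTop_of_neg (neg_neg_of_pos (hw i)))
  refine ((isBigO_refl (fun t => Real.exp (-a * t)) atTop).mul (h.isBigO_one ℝ)).congr_right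
    fun t => mul_one _

theorem constantCoeff_prod_expSubOneDiv_ne_zero (hw : ∀ i, 0 < w i) :
    PowerSeries.constantCoeff (∏ i, expSubOneDiv (w i)) ≠ 0 := by
  rw [map_prod, Finset.prod_ne_zero_iff]
  intro i _
  simpa [expSubOneDiv, ← PowerSeries.coeff_zero_eq_constantCoeff_apply] using (hw i).ne'

/-- Multiplying each `1 - e^{-w_i t}` by `e^{w_i t}` turns the kernel into the generating function;
with denominators cleared, the right side is `e^{(∑ w_i - a) t}`. -/
theorem hasRightExpansion_pow_mul_barnesKernel (hw : ∀ i, 0 < w i) :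
    HasRightExpansion (fun t => t ^ r * barnesKernel w a t) (barnesBernoulliSeries w a) := by
  refine HasRightExpansion.mul_inv_of_mul_eq
    (HasRightExpansion.prod Finset.univ fun i _ => HasRightExpansion.exp_sub_one_div (w i))
    (HasRightExpansion.exp_mul ((∑ i, w i) - a)) (constantCoeff_prod_expSubOneDiv_ne_zero hw) ?_
  filter_upwards [self_mem_nhdsWithin] with t ht
  have ht' : 0 < t := ht
  have key : ∀ i, (Real.exp (w i * t) - 1) / t * (t * (1 - Real.exp (-w i * t))⁻¹)
      = Real.exp (w i * t) := fun i => by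
    have h1 := (one_sub_exp_neg_mul_pos (hw i) ht').ne'
    have h2 : Real.exp (w i * t) * Real.exp (-w i * t) = 1 := by
      rw [← Real.exp_add]; simp
    rw [neg_mul] at h1 h2 ⊢
    field_simp
    linear_combination h2
  have hpow : t ^ r = ∏ _i : Fin r, t := by simp
  rw [barnesKernel, mul_left_comm (t ^ r), hpow, ← Finset.prod_mul_distrib, mul_left_comm,
    ← Finset.prod_mul_distrib, Finset.prod_congr rfl fun i _ => key i, ← Real.exp_sum,
    ← Real.exp_add, ← Finset.sum_mul]
  congr 1
  ring

theorem barnesKernel_sub_sum_isBigO (hw : ∀ i, 0 < w i) (K : ℕ) :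
    (fun t => barnesKernel w a t - ∑ k ∈ Finset.range K,
      PowerSeries.coeff k (barnesBernoulliSeries w a) * t ^ ((k : ℝ) - r))
      =O[𝓝[>] 0] fun t => t ^ ((K : ℝ) - r) := by
  have h := ((hasRightExpansion_pow_mul_barnesKernel (a := a) hw).isBigO K).mul
    (isBigO_refl (fun t : ℝ => t ^ (-(r : ℝ))) (𝓝[>] 0))
  have hsplit : ∀ (k : ℕ) {t : ℝ}, 0 < t → t ^ ((k : ℝ) - r) = t ^ k * t ^ (-(r : ℝ)) :=
    fun k t ht => by rw [sub_eq_add_neg, Real.rpow_add ht, Real.rpow_natCast]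
  refine h.congr' ?_ ?_
  · filter_upwards [self_mem_nhdsWithin] with t ht
    have ht' : 0 < t := ht
    rw [sub_mul, Finset.sum_mul]
    congr 1
    · rw [Real.rpow_neg ht'.le, Real.rpow_natCast]
      field_simp
    · exact Finset.sum_congr rfl fun k _ => by rw [hsplit k ht', mul_assoc]
  · filter_upwards [self_mem_nhdsWithin] with t ht
    rw [hsplit K ht]

end Barnes

/-! ### Analytic continuation and its uniqueness -/

section BarnesContinuation

variable {r : ℕ} {w : Fin r → ℝ} {a : ℝ}

/-- The coefficient of `t ^ (k - r)` in the expansion of `barnesKernel w a t` at `t = 0`. -/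
noncomputable def barnesCoeff (w : Fin r → ℝ) (a : ℝ) (k : ℕ) : ℝ :=
  PowerSeries.coeff k (barnesBernoulliSeries w a)

/-- `barnesKernel` minus its first `K` expansion terms on `(0, 1]`. -/
noncomputable def barnesRemainder (w : Fin r → ℝ) (a : ℝ) (K : ℕ) (t : ℝ) : ℝ :=
  barnesKernel w a t -
    ∑ k ∈ Finset.range K, barnesCoeff w a k * indicator (Ioc 0 1) (fun t => t ^ ((k : ℝ) - r)) t

theorem barnesRemainder_isBigO_nhdsGT (hw : ∀ i, 0 < w i) (K : ℕ) :
    barnesRemainder w a K =O[𝓝[>] 0] fun t => t ^ ((K : ℝ) - r) := by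
  refine (barnesKernel_sub_sum_isBigO (a := a) hw K).congr' ?_ EventuallyEq.rfl
  filter_upwards [Ioc_mem_nhdsGT (zero_lt_one' ℝ)] with t ht
  simp only [barnesRemainder, barnesCoeff, indicator_of_mem ht]

/-- Cutting the subtracted powers off at `t = 1` keeps the exponential decay at infinity. -/
theorem barnesRemainder_isBigO_atTop (hw : ∀ i, 0 < w i) (K : ℕ) :
    barnesRemainder w a K =O[atTop] fun t => Real.exp (-a * t) := by
  refine (barnesKernel_isBigO_atTop (a := a) hw).congr' ?_ EventuallyEq.rfl
  filter_upwards [eventually_gt_atTop 1] with t ht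
  have : t ∉ Ioc (0 : ℝ) 1 := fun h => ht.not_ge h.2
  simp [barnesRemainder, indicator_of_notMem this]

theorem locallyIntegrableOn_barnesRemainder (hw : ∀ i, 0 < w i) (K : ℕ) :
    MeasureTheory.LocallyIntegrableOn (fun t => (barnesRemainder w a K t : ℂ)) (Ioi 0) := by
  induction K with
  | zero =>
    simp only [barnesRemainder, Finset.range_zero, Finset.sum_empty, sub_zero]
    exact (Complex.continuous_ofReal.comp_continuousOn
      (continuousOn_barnesKernel hw)).locallyIntegrableOn measurableSet_Ioi
  | succ K ih =>
    have h : MeasureTheory.LocallyIntegrableOn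
        (fun t => ((barnesCoeff w a K * t ^ ((K : ℝ) - r) : ℝ) : ℂ)) (Ioi 0) := by
      refine (Complex.continuous_ofReal.comp_continuousOn
        (continuousOn_const.mul fun t ht => ?_)).locallyIntegrableOn measurableSet_Ioi
      exact (Real.continuousAt_rpow_const _ _ (Or.inl (mem_Ioi.1 ht).ne')).continuousWithinAt
    have h' : MeasureTheory.LocallyIntegrableOn (indicator (Ioc 0 1)
        (fun t => ((barnesCoeff w a K * t ^ ((K : ℝ) - r) : ℝ) : ℂ))) (Ioi 0) := fun x hx => by
      obtain ⟨s, hs, hi⟩ := h x hx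
      exact ⟨s, hs, hi.indicator measurableSet_Ioc⟩
    refine Eq.subst (motive := fun F : ℝ → ℂ => MeasureTheory.LocallyIntegrableOn F (Ioi 0))
      (funext fun t => ?_) (ih.sub h')
    simp only [barnesRemainder, Finset.sum_range_succ, Pi.sub_apply]
    by_cases ht : t ∈ Ioc (0 : ℝ) 1
    · simp only [indicator_of_mem ht]; push_cast; ring
    · simp only [indicator_of_notMem ht]; push_cast; ring

theorem mellinConvergent_barnesRemainder (hw : ∀ i, 0 < w i) (ha : 0 < a) {K : ℕ} {s : ℂ}
    (hs : (r : ℝ) - K < s.re) : MellinConvergent (fun t => (barnesRemainder w a K t : ℂ)) s :=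
  mellinConvergent_of_isBigO_rpow_exp ha (locallyIntegrableOn_barnesRemainder hw K)
    (Complex.isBigO_ofReal_left.2 (barnesRemainder_isBigO_atTop hw K))
    (Complex.isBigO_ofReal_left.2 (by simpa using barnesRemainder_isBigO_nhdsGT (a := a) hw K)) hs

theorem differentiableAt_mellin_barnesRemainder (hw : ∀ i, 0 < w i) (ha : 0 < a) {K : ℕ} {s : ℂ}
    (hs : (r : ℝ) - K < s.re) :
    DifferentiableAt ℂ (mellin fun t => (barnesRemainder w a K t : ℂ)) s :=
  mellin_differentiableAt_of_isBigO_rpow_exp ha (locallyIntegrableOn_barnesRemainder hw K)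
    (Complex.isBigO_ofReal_left.2 (barnesRemainder_isBigO_atTop hw K))
    (Complex.isBigO_ofReal_left.2 (by simpa using barnesRemainder_isBigO_nhdsGT (a := a) hw K)) hs

/-- The power `t ^ (K - r)` on `(0, 1]` has Mellin transform `1 / (s - (r - K))` in this half-plane:
passing to the next remainder splits off exactly one pole. -/
theorem mellin_barnesRemainder_eq (hw : ∀ i, 0 < w i) (ha : 0 < a) {K : ℕ} {s : ℂ}
    (hs : (r : ℝ) - K < s.re) :
    mellin (fun t => (barnesRemainder w a K t : ℂ)) s =
      mellin (fun t => (barnesRemainder w a (K + 1) t : ℂ)) s +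
        barnesCoeff w a K / (s - ((r : ℂ) - K)) := by
  have h1 := mellinConvergent_barnesRemainder (K := K + 1) hw ha (s := s) (by push_cast; linarith)
  have h2 := hasMellin_cpow_Ioc ((K : ℂ) - r) (s := s) (by simp; linarith)
  have h3 := (hasMellin_add h1 (hasMellin_const_smul h2.1 (barnesCoeff w a K : ℂ)).1).2
  rw [mellin_const_smul, h2.2, smul_eq_mul, mul_one_div,
    show s + ((K : ℂ) - r) = s - ((r : ℂ) - K) by ring] at h3
  rw [← h3]
  refine MeasureTheory.setIntegral_congr_fun measurableSet_Ioi fun t ht => ?_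
  have ht' : 0 < t := ht
  simp only [barnesRemainder, Finset.sum_range_succ, smul_eq_mul]
  congr 1
  by_cases ht1 : t ∈ Ioc (0 : ℝ) 1
  · simp only [indicator_of_mem ht1]
    push_cast
    rw [Complex.ofReal_cpow ht'.le]
    push_cast
    ring
  · simp only [indicator_of_notMem ht1]; push_cast; ring

/-- The function `s ↦ Γ(s)⁻¹ / (s - p)`, with its removable singularity filled in when
`Γ(p)⁻¹ = 0`. -/
noncomputable def invGammaDiv (p s : ℂ) : ℂ :=
  dslope (fun s => (Complex.Gamma s)⁻¹) p s + (Complex.Gamma p)⁻¹ * (s - p)⁻¹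

theorem invGammaDiv_of_ne {p s : ℂ} (h : s ≠ p) :
    invGammaDiv p s = (Complex.Gamma s)⁻¹ / (s - p) := by
  rw [invGammaDiv, dslope_of_ne _ h, slope_def_field]
  ring

theorem differentiable_dslope_inv_Gamma (p : ℂ) :
    Differentiable ℂ (dslope (fun s => (Complex.Gamma s)⁻¹) p) := by
  rw [← differentiableOn_univ]
  exact (Complex.differentiableOn_dslope univ_mem).2
    Complex.differentiable_one_div_Gamma.differentiableOn

theorem differentiableAt_invGammaDiv {p s : ℂ} (h : s ≠ p ∨ Complex.Gamma p = 0) :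
    DifferentiableAt ℂ (invGammaDiv p) s := by
  refine (differentiable_dslope_inv_Gamma p s).add ?_
  rcases h with h | h
  · exact ((differentiableAt_id.sub_const p).inv (sub_ne_zero.2 h)).const_mul _
  -- The coefficient `(Γ p)⁻¹` of the polar part is zero, leaving only the entire `dslope`.
  · simp [h]

theorem meromorphicAt_invGammaDiv (p s : ℂ) : MeromorphicAt (invGammaDiv p) s := by
  have h1 : MeromorphicAt (dslope (fun s => (Complex.Gamma s)⁻¹) p) s :=
    ((differentiable_dslope_inv_Gamma p).analyticAt s).meromorphicAt
  have h2 : MeromorphicAt (fun s : ℂ => s - p) s :=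
    ((differentiable_id.sub_const p).analyticAt s).meromorphicAt
  exact h1.add ((MeromorphicAt.const _ s).mul h2.inv)

/-- The continuation of the Barnes zeta function to `Re s > r - K`. -/
noncomputable def barnesZetaStrip (w : Fin r → ℝ) (a : ℝ) (K : ℕ) (s : ℂ) : ℂ :=
  mellin (fun t => (barnesRemainder w a K t : ℂ)) s * (Complex.Gamma s)⁻¹ +
    ∑ k ∈ Finset.range K, barnesCoeff w a k * invGammaDiv ((r : ℂ) - k) s

theorem barnesZetaStrip_succ (hw : ∀ i, 0 < w i) (ha : 0 < a) {K : ℕ} {s : ℂ}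
    (hs : (r : ℝ) - K < s.re) : barnesZetaStrip w a (K + 1) s = barnesZetaStrip w a K s := by
  have hne : s ≠ (r : ℂ) - K := by
    rintro rfl
    simp at hs
  rw [barnesZetaStrip, barnesZetaStrip, mellin_barnesRemainder_eq hw ha hs, Finset.sum_range_succ,
    invGammaDiv_of_ne hne]
  ring

theorem barnesZetaStrip_of_le (hw : ∀ i, 0 < w i) (ha : 0 < a) {K L : ℕ} (hKL : K ≤ L) {s : ℂ}
    (hs : (r : ℝ) - K < s.re) : barnesZetaStrip w a L s = barnesZetaStrip w a K s := by
  induction L, hKL using Nat.le_induction with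
  | base => rfl
  | succ L hL ih =>
    have : (K : ℝ) ≤ L := Nat.cast_le.2 hL
    rw [barnesZetaStrip_succ hw ha (by linarith), ih]

/-- The continuation of the Barnes zeta function to the whole plane. -/
noncomputable def barnesZetaCont (w : Fin r → ℝ) (a : ℝ) (s : ℂ) : ℂ :=
  barnesZetaStrip w a (⌊(r : ℝ) - s.re⌋₊ + 1) s

theorem barnesZetaCont_eq_strip (hw : ∀ i, 0 < w i) (ha : 0 < a) {K : ℕ} {s : ℂ}
    (hs : (r : ℝ) - K < s.re) : barnesZetaCont w a s = barnesZetaStrip w a K s := by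
  have h : (r : ℝ) - (⌊(r : ℝ) - s.re⌋₊ + 1 : ℕ) < s.re := by
    have := Nat.lt_floor_add_one ((r : ℝ) - s.re)
    push_cast
    linarith
  rw [barnesZetaCont, ← barnesZetaStrip_of_le hw ha (le_max_left _ K) h,
    barnesZetaStrip_of_le hw ha (le_max_right _ K) hs]

theorem exists_barnesZetaCont_eventuallyEq_strip (hw : ∀ i, 0 < w i) (ha : 0 < a) (s : ℂ) :
    ∃ K : ℕ, (r : ℝ) - K < s.re ∧ barnesZetaStrip w a K =ᶠ[𝓝 s] barnesZetaCont w a := by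
  obtain ⟨K, hK⟩ := exists_nat_gt ((r : ℝ) - s.re)
  have hK' : (r : ℝ) - K < s.re := by linarith
  exact ⟨K, hK', ((Complex.continuous_re.continuousAt.eventually_const_lt hK').mono
    fun z hz => (barnesZetaCont_eq_strip hw ha hz).symm)⟩

theorem isBarnesZeta_barnesZetaCont (hw : ∀ i, 0 < w i) (ha : 0 < a) :
    IsBarnesZeta w a (barnesZetaCont w a) where
  hasSum s hs := by
    rw [barnesZetaCont_eq_strip (K := 0) hw ha (by simpa using hs)]
    simpa [barnesZetaStrip, barnesRemainder] using hasSum_mellin_barnesKernel hw ha hs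
  differentiableOn s hs := by
    obtain ⟨K, hK, he⟩ := exists_barnesZetaCont_eventuallyEq_strip (a := a) hw ha s
    refine (DifferentiableAt.congr_of_eventuallyEq ?_ he.symm).differentiableWithinAt
    refine ((differentiableAt_mellin_barnesRemainder hw ha hK).mul
      (Complex.differentiable_one_div_Gamma s)).add (DifferentiableAt.fun_sum fun k _ => ?_)
    refine (differentiableAt_invGammaDiv ?_).const_mul _
    rcases lt_or_ge k r with hk | hk
    · left
      have := hs (r - k) (by omega) (by omega)
      rwa [Nat.cast_sub hk.le] at this
    · right
      have : (r : ℂ) - k = -((k - r : ℕ) : ℂ) := by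
        rw [Nat.cast_sub hk]; ring
      rw [this, Complex.Gamma_neg_nat_eq_zero]
  meromorphicOn s _ := by
    obtain ⟨K, hK, he⟩ := exists_barnesZetaCont_eventuallyEq_strip (a := a) hw ha s
    refine MeromorphicAt.congr ?_ (he.filter_mono nhdsWithin_le_nhds)
    have h1 : AnalyticAt ℂ (mellin fun t => (barnesRemainder w a K t : ℂ)) s := by
      rw [Complex.analyticAt_iff_eventually_differentiableAt]
      exact (Complex.continuous_re.continuousAt.eventually_const_lt hK).mono
        fun z hz => differentiableAt_mellin_barnesRemainder hw ha hz
    refine (h1.meromorphicAt.mul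
      (Complex.differentiable_one_div_Gamma.analyticAt s).meromorphicAt).add
      (MeromorphicAt.fun_sum fun k _ => ?_)
    exact (MeromorphicAt.const _ s).mul (meromorphicAt_invGammaDiv _ s)

/-- Identity theorem: the plane minus finitely many points is connected, and both functions equal
the series near `r + 1`. -/
theorem IsBarnesZeta.eq {Z Z' : ℂ → ℂ} (h : IsBarnesZeta w a Z) (h' : IsBarnesZeta w a Z') {s : ℂ}
    (hs : ∀ j : ℕ, 1 ≤ j → j ≤ r → s ≠ (j : ℂ)) : Z s = Z' s := by
  set U : Set ℂ := {s : ℂ | ∀ j : ℕ, 1 ≤ j → j ≤ r → s ≠ (j : ℂ)} with hU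
  have hUc : U = ((Finset.Icc 1 r).image (fun j : ℕ => (j : ℂ)) : Set ℂ)ᶜ := by
    ext z
    simp only [hU, mem_ofPred_eq, mem_compl_iff, Finset.coe_image, mem_image, Finset.mem_coe,
      Finset.mem_Icc, not_exists, not_and, and_imp, ne_comm (a := z)]
  have hopen : IsOpen U := by
    rw [hUc]
    exact (Finset.finite_toSet _).isClosed.isOpen_compl
  have hconn : IsPreconnected U := by
    rw [hUc]
    exact ((Finset.countable_toSet _).isConnected_compl_of_one_lt_rank (by simp)).isPreconnected
  have hmem : ((r + 1 : ℕ) : ℂ) ∈ U := fun j _ hj he => by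
    have := Nat.cast_injective he
    omega
  have hev : Z =ᶠ[𝓝 ((r + 1 : ℕ) : ℂ)] Z' := by
    have hlt : (r : ℝ) < ((r + 1 : ℕ) : ℂ).re := by simp
    exact (Complex.continuous_re.continuousAt.eventually_const_lt hlt).mono
      fun z hz => (h.hasSum z hz).unique (h'.hasSum z hz)
  exact (h.differentiableOn.analyticOnNhd hopen).eqOn_of_preconnected_of_eventuallyEq
    (h'.differentiableOn.analyticOnNhd hopen) hconn hmem hev hs

theorem barnesZeta_eq_barnesZetaCont (hw : ∀ i, 0 < w i) (ha : 0 < a) {s : ℂ}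
    (hs : ∀ j : ℕ, 1 ≤ j → j ≤ r → s ≠ (j : ℂ)) : barnesZeta s w a = barnesZetaCont w a s := by
  have h : ∃ Z : ℂ → ℂ, IsBarnesZeta w a Z := ⟨_, isBarnesZeta_barnesZetaCont hw ha⟩
  rw [barnesZeta, dif_pos h]
  exact h.choose_spec.eq (isBarnesZeta_barnesZetaCont hw ha) hs

/-! ### Real zeros between consecutive poles -/

theorem mellin_ofReal_eq (f : ℝ → ℝ) (σ : ℝ) :
    mellin (fun t => (f t : ℂ)) σ = ((mellin (fun t => (f t : ℂ)) σ).re : ℂ) := by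
  have : mellin (fun t => (f t : ℂ)) σ = ((∫ t in Ioi (0 : ℝ), t ^ (σ - 1) * f t : ℝ) : ℂ) := by
    rw [mellin, ← integral_complex_ofReal]
    refine MeasureTheory.setIntegral_congr_fun measurableSet_Ioi fun t ht => ?_
    have ht' : 0 < t := ht
    simp only [smul_eq_mul]
    rw [Complex.ofReal_mul, Complex.ofReal_cpow ht'.le]
    push_cast
    rfl
  rw [this, Complex.ofReal_re]

/-- A continuous function plus two simple poles, at the endpoints of an interval and with residues
of the same sign, vanishes inside the interval. -/
theorem exists_add_div_add_div_eq_zero {φ : ℝ → ℝ} {L R A B : ℝ} (hLR : L < R)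
    (hφ : ContinuousOn φ (Icc L R)) (hAB : 0 < A * B) :
    ∃ σ ∈ Ioo L R, φ σ + B / (σ - R) + A / (σ - L) = 0 := by
  -- Clearing denominators replaces the infinite limits by the endpoint values `A (L - R)` and `B (R
  -- - L)`, which have opposite signs.
  set ψ : ℝ → ℝ := fun σ => φ σ * ((σ - R) * (σ - L)) + B * (σ - L) + A * (σ - R) with hψ
  have hc : ContinuousOn ψ (Icc L R) := by fun_prop
  have hL : ψ L = A * (L - R) := by simp [hψ]
  have hR : ψ R = B * (R - L) := by simp [hψ]
  obtain ⟨σ, hσ, h0⟩ : ∃ σ ∈ Ioo L R, ψ σ = 0 := by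
    rcases pos_and_pos_or_neg_and_neg_of_mul_pos hAB with ⟨hA, hB⟩ | ⟨hA, hB⟩
    · exact intermediate_value_Ioo hLR.le hc ⟨by rw [hL]; nlinarith, by rw [hR]; nlinarith⟩
    · exact intermediate_value_Ioo' hLR.le hc ⟨by rw [hR]; nlinarith, by rw [hL]; nlinarith⟩
  refine ⟨σ, hσ, ?_⟩
  have h1 : σ - R ≠ 0 := (sub_neg.2 hσ.2).ne
  have h2 : σ - L ≠ 0 := (sub_pos.2 hσ.1).ne'
  field_simp
  linear_combination h0

theorem exists_barnesZetaCont_eq_zero (hw : ∀ i, 0 < w i) (ha : 0 < a) (n : ℕ)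
    (hB : 0 < barnesCoeff w a (n + 1) * barnesCoeff w a n) :
    ∃ σ ∈ Ioo ((r : ℝ) - n - 1) (r - n), barnesZetaCont w a (σ : ℂ) = 0 := by
  -- Order `n + 2` makes the Mellin part holomorphic for `Re s > r - n - 2`, hence continuous on the
  -- closed interval; the poles with `k < n` lie to its right.
  set M : ℂ → ℂ := mellin fun t => (barnesRemainder w a (n + 2) t : ℂ) with hM
  have hcont : ContinuousOn (fun σ : ℝ => (M σ).re +
      ∑ k ∈ Finset.range n, barnesCoeff w a k / (σ - (r - k))) (Icc ((r : ℝ) - n - 1) (r - n)) := by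
    intro σ hσ
    refine ContinuousAt.continuousWithinAt (ContinuousAt.add ?_ ?_)
    · have h1 : ContinuousAt M (σ : ℂ) :=
        (differentiableAt_mellin_barnesRemainder hw ha (by
          have := hσ.1
          push_cast
          rw [Complex.ofReal_re]
          linarith)).continuousAt
      exact Complex.continuous_re.continuousAt.comp
        (ContinuousAt.comp (f := fun σ : ℝ => (σ : ℂ)) h1 Complex.continuous_ofReal.continuousAt)
    · refine tendsto_finsetSum _ fun k hk => ?_
      have hk' : (k : ℝ) < n := Nat.cast_lt.2 (Finset.mem_range.1 hk)
      have hne : σ - ((r : ℝ) - k) ≠ 0 := by have := hσ.2; intro h; linarith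
      exact ContinuousAt.div (by fun_prop) (by fun_prop) hne
  obtain ⟨σ, hσ, h0⟩ := exists_add_div_add_div_eq_zero (by linarith) hcont hB
  refine ⟨σ, hσ, ?_⟩
  have hne : ∀ k ∈ Finset.range (n + 2), (σ : ℂ) ≠ (r : ℂ) - k := fun k _ h => by
    have h' : σ = (r : ℝ) - k := by exact_mod_cast h
    have h1 : (k : ℝ) < (n + 1 : ℕ) := by push_cast; linarith [hσ.1]
    have h2 : (n : ℝ) < k := by linarith [hσ.2]
    have h1' := Nat.cast_lt.1 h1
    have h2' := Nat.cast_lt.1 h2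
    omega
  rw [barnesZetaCont_eq_strip (K := n + 2) hw ha (by
    have := hσ.1
    push_cast
    rw [Complex.ofReal_re]
    linarith), barnesZetaStrip,
    Finset.sum_congr rfl fun k hk => by rw [invGammaDiv_of_ne (hne k hk)], mellin_ofReal_eq]
  have h0' := congrArg (fun x : ℝ => (x : ℂ) * (Complex.Gamma σ)⁻¹) h0
  have hsum : ∑ k ∈ Finset.range n, (barnesCoeff w a k : ℂ) *
      ((Complex.Gamma σ)⁻¹ / ((σ : ℂ) - ((r : ℂ) - k))) =
      (∑ k ∈ Finset.range n, (barnesCoeff w a k : ℂ) / ((σ : ℂ) - ((r : ℂ) - k))) *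
        (Complex.Gamma σ)⁻¹ := by
    rw [Finset.sum_mul]
    exact Finset.sum_congr rfl fun k _ => by ring
  rw [Finset.sum_range_succ, Finset.sum_range_succ, hsum, ← hM]
  push_cast at h0' ⊢
  rw [zero_mul] at h0'
  rw [← h0', sub_add_eq_sub_sub]
  ring

end BarnesContinuation

theorem theorem3p1 (r : ℕ) (hr : 1 ≤ r) (w : Fin r → ℝ) (hw : ∀ i, 0 < w i)
    (a : ℝ) (ha : 0 < a) (N : ℤ) (hN : -(r : ℤ) ≤ N)
    (hB : 0 < barnesBernoulli ((r : ℤ) + N + 1).toNat a w *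
      barnesBernoulli ((r : ℤ) + N).toNat a w) :
    ∃ σ : ℝ, σ ∈ Set.Ioo (-(N : ℝ) - 1) (-(N : ℝ)) ∧ barnesZeta (σ : ℂ) w a = 0 := by
  obtain ⟨n, hn⟩ : ∃ n : ℕ, (n : ℤ) = r + N := ⟨((r : ℤ) + N).toNat, by omega⟩
  have hn1 : ((r : ℤ) + N + 1).toNat = n + 1 := by omega
  have hn0 : ((r : ℤ) + N).toNat = n := by omega
  have hNn : (-(N : ℝ)) = r - n := by
    have : (n : ℝ) = r + N := by exact_mod_cast hn
    linarith
  rw [hn1, hn0, barnesBernoulli, barnesBernoulli, mul_mul_mul_comm] at hB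
  obtain ⟨σ, hσ, h0⟩ := exists_barnesZetaCont_eq_zero hw ha n
    (pos_of_mul_pos_right hB (by positivity))
  rw [← hNn] at hσ
  refine ⟨σ, hσ, ?_⟩
  -- For `N < 0` the interval may lie among the poles `1, ..., r`, but no integer lies strictly
  -- between `-N - 1` and `-N`.
  rw [barnesZeta_eq_barnesZetaCont hw ha fun j _ _ h => ?_, h0]
  have hj : σ = j := by exact_mod_cast h
  rw [hj] at hσ
  have h1 : -N - 1 < (j : ℤ) := by exact_mod_cast hσ.1
  have h2 : (j : ℤ) < -N := by exact_mod_cast hσ.2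
  omega
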